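/- Let $G$ be a finite connected undirected graph without loops, in which multiple edges are allowed, and suppose that $G$ is subcubic, that is, its maximum degree satisfies $\Delta(G)\le 3$. A proper $t$-edge coloring of $G$ is a map $E(G)\to\{1,\dots,t\}$ that assigns distinct colors to any two distinct edges sharing an endpoint. The chromatic index $\chi'(G)$ is the least integer $t\ge 0$ for which $G$ has a proper $t$-edge coloring. The graph $G$ is called interval colorable if for some integer $t \ge 0$ it has a proper $t$-edge coloring such that, for every vertex $v$, the colors of the edges incident with $v$ form an interval of integers (the empty set, which occurs at an isolated vertex, counts as an interval). Then $G$ is interval colorable if and only if $\chi'(G)=\Delta(G)$. -/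

import Mathlib

namespace Graph

variable {α β : Type*}

/-- The degree of `v`: the number of edges incident with `v` (for graphs without loops). -/
noncomputable def degree (G : Graph α β) (v : α) : ℕ :=
  (G.incidenceSet v).ncard

/-- The maximum degree `Δ(G)` of a finite loopless graph. -/
noncomputable def maxDegree (G : Graph α β) : ℕ :=
  sSup (G.degree '' G.vertexSet)

/-- `G` is connected: it has a vertex, and any two vertices are joined by a walk. -/
def IsConnected (G : Graph α β) : Prop :=
  G.vertexSet.Nonempty ∧ ∀ x ∈ G.vertexSet, ∀ y ∈ G.vertexSet, Relation.ReflTransGen G.Adj x y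

/-- `c` is a proper `t`-edge coloring of `G`: the edges receive colors from `{1, …, t}`, and
adjacent edges (distinct edges with a common end) receive distinct colors.
The values of `c` outside the edge set are irrelevant. -/
def IsProperEdgeColoring (G : Graph α β) (t : ℕ) (c : β → ℕ) : Prop :=
  (∀ e ∈ G.edgeSet, c e ∈ Set.Icc 1 t) ∧
    ∀ e f v, e ≠ f → G.Inc e v → G.Inc f v → c e ≠ c f

/-- The chromatic index `χ'(G)` of a finite loopless graph: the least `t` for which a proper
`t`-edge coloring exists. -/
noncomputable def chromaticIndex (G : Graph α β) : ℕ :=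
  sInf {t | ∃ c, G.IsProperEdgeColoring t c}

/-- `c` is an interval `t`-coloring of `G`: a proper `t`-edge coloring such that at every vertex
the colors of the incident edges form an interval of integers (empty at an isolated vertex). -/
def IsIntervalColoring (G : Graph α β) (t : ℕ) (c : β → ℕ) : Prop :=
  G.IsProperEdgeColoring t c ∧ ∀ v ∈ G.vertexSet, (c '' G.incidenceSet v).OrdConnected

/-- `G` is interval colorable: it has an interval `t`-coloring for some `t`. -/
def IsIntervalColorable (G : Graph α β) : Prop :=
  ∃ t c, G.IsIntervalColoring t c

end Graph

namespace Graph

variable {α β : Type*} {G : Graph α β} {c : β → ℕ} {t : ℕ} {e f g : β} {u v w x y z : α} {i : ℕ}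
variable {E : Finset β} {wt : β → ℕ} {D : α → ℕ}

/-! Reducing an interval coloring modulo `Δ` keeps it proper, because the colors at a vertex are at
most `Δ` consecutive integers. Conversely, a set of colors from `{1, 2}` is always an interval, so
the real case is `Δ = 3`, starting from a proper 3-coloring.

`liftColoring` sends 2 to 3, 3 to 4 or 1, and 1 to 2 or 5. The trouble is a tight edge `uv`: the end
`u` forces its value to be 2, so a 3-edge `f = vw` must drop to 1. This is harmless at `w` if the
1-edge there exists and lifts to 2, which follows if `w` sees 1 and 2 and the far end of that 1-edge
sees 2.

These conditions hold for a coloring of least weight in color 1, an edge weighing more the farther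
it is from the vertices of degree 3: if one failed, a Kempe swap or a local recoloring would
contradict minimality. Recolorings that put color 1 on `f` need `f` lighter than `uv`. For this,
`exists_forall_isTight_le` arranges `D v ≤ D u`; as `v` has degree at most 2, its neighbor closer to
a cubic vertex is then `w`. -/

/-- Some edge at `x` has color `i`. -/
def HasColor (G : Graph α β) (c : β → ℕ) (x : α) (i : ℕ) : Prop :=
  ∃ e, G.Inc e x ∧ c e = i

theorem IsProperEdgeColoring.eq_of_inc (hc : G.IsProperEdgeColoring t c)
    (he : G.Inc e x) (hf : G.Inc f x) (h : c e = c f) : e = f := by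
  by_contra hne
  exact hc.2 e f x hne he hf h

theorem IsProperEdgeColoring.color_cases (hc : G.IsProperEdgeColoring 3 c) (he : G.Inc e x) :
    c e = 1 ∨ c e = 2 ∨ c e = 3 := by
  have := hc.1 e he.edge_mem
  rw [Set.mem_Icc] at this
  omega

/-! ### Minimizing the weight of color 1 -/

section Weight

/-- The total weight of the edges of color `1`. -/
noncomputable def colorOneWeight (E : Finset β) (wt : β → ℕ) (c : β → ℕ) : ℕ :=
  ∑ e ∈ E, if c e = 1 then wt e else 0

theorem colorOneWeight_update [DecidableEq β] (he : e ∈ E) :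
    colorOneWeight E wt (Function.update c e i) + (if c e = 1 then wt e else 0) =
      colorOneWeight E wt c + (if i = 1 then wt e else 0) := by
  unfold colorOneWeight
  rw [← Finset.add_sum_erase _ _ he, ← Finset.add_sum_erase (a := e) E _ he]
  have : ∑ x ∈ E.erase e, (if Function.update c e i x = 1 then wt x else 0) =
      ∑ x ∈ E.erase e, if c x = 1 then wt x else 0 := by
    refine Finset.sum_congr rfl fun x hx ↦ ?_
    rw [Function.update_of_ne (Finset.ne_of_mem_erase hx)]
  rw [this, Function.update_self]
  ring

/-- A proper `3`-edge coloring of least weight in color `1`. -/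
structure IsLightest (G : Graph α β) (E : Finset β) (wt : β → ℕ) (c : β → ℕ) : Prop where
  proper : G.IsProperEdgeColoring 3 c
  le : ∀ c', G.IsProperEdgeColoring 3 c' → colorOneWeight E wt c ≤ colorOneWeight E wt c'

theorem IsProperEdgeColoring.exists_isLightest (hc : G.IsProperEdgeColoring 3 c) (E : Finset β)
    (wt : β → ℕ) : ∃ c', G.IsLightest E wt c' := by
  obtain ⟨c', hc', h⟩ := exists_minimalFor_of_wellFoundedLT
    (fun c ↦ G.IsProperEdgeColoring 3 c) (colorOneWeight E wt) ⟨c, hc⟩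
  refine ⟨c', hc', fun d hd ↦ ?_⟩
  by_contra hlt
  exact hlt (h hd (le_of_not_ge hlt))

end Weight

/-! ### Kempe chains in the colors 2 and 3 -/

section Kempe

/-- One step of the path alternating between the colors `2` and `3`; the state `(x, i)` stands for
having reached `x` along an edge of color `i`. -/
def KempeStep (G : Graph α β) (c : β → ℕ) (p q : α × ℕ) : Prop :=
  (p.2 = 2 ∧ q.2 = 3 ∨ p.2 = 3 ∧ q.2 = 2) ∧ ∃ e, G.IsLink e p.1 q.1 ∧ c e = q.2

/-- The vertices on the path in the colors `2` and `3` that leaves `u` along the edge of color `2`. -/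
def kempeChain (G : Graph α β) (c : β → ℕ) (u : α) : Set α :=
  {x | ∃ i, Relation.ReflTransGen (G.KempeStep c) (u, 3) (x, i)}

/-- `K` is a union of components of the subgraph of the edges of colors `2` and `3`. -/
def IsKempeClosed (G : Graph α β) (c : β → ℕ) (K : Set α) : Prop :=
  ∀ ⦃e x y⦄, G.IsLink e x y → c e = 2 ∨ c e = 3 → x ∈ K → y ∈ K

open Classical in
/-- Exchange the colors `2` and `3` on the edges that meet `K`. -/
noncomputable def kempeSwap (G : Graph α β) (c : β → ℕ) (K : Set α) (e : β) : ℕ :=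
  if ∃ x ∈ K, G.Inc e x then Equiv.swap 2 3 (c e) else c e

theorem self_mem_kempeChain : u ∈ G.kempeChain c u := ⟨3, .refl⟩

theorem kempeStep_rightUnique (hc : G.IsProperEdgeColoring t c) :
    Relator.RightUnique (G.KempeStep c) := by
  rintro ⟨x, i⟩ ⟨y, j⟩ ⟨z, k⟩ ⟨h1, e, he, hce⟩ ⟨h2, f, hf, hcf⟩
  simp only at h1 h2 he hce hf hcf
  obtain rfl : j = k := by omega
  obtain rfl := hc.eq_of_inc he.inc_left hf.inc_left (hce.trans hcf.symm)
  rw [he.right_unique hf]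

/-- The initial state `(u, 3)` pretends that `u` was entered along color 3; no edge is lost, since
`u` misses 3. -/
theorem isKempeClosed_kempeChain (hc : G.IsProperEdgeColoring t c) (hu : ¬ G.HasColor c u 3) :
    G.IsKempeClosed c (G.kempeChain c u) := by
  rintro e x y he hce ⟨i, hi⟩
  rcases Relation.ReflTransGen.cases_tail hi with h | ⟨⟨p, k⟩, hp, hk, f, hf, hcf⟩
  · obtain ⟨rfl, rfl⟩ := Prod.mk.inj h
    rcases hce with hce | hce
    · exact ⟨2, .single ⟨.inr ⟨rfl, rfl⟩, e, he, hce⟩⟩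
    · exact absurd ⟨e, he.inc_left, hce⟩ hu
  · simp only at hk hf hcf
    by_cases h : c e = i
    · obtain rfl := hc.eq_of_inc he.inc_left hf.inc_right (h.trans hcf.symm)
      rw [he.right_unique hf.symm]
      exact ⟨k, hp⟩
    · exact ⟨c e, hi.tail ⟨by simp only; omega, e, he, rfl⟩⟩

/-- The walk is deterministic, so one of `x`, `y` is reached no later than the other, and it cannot
be continued from a vertex other than `u` that misses 2 or 3. -/
theorem eq_of_mem_kempeChain (hc : G.IsProperEdgeColoring t c)
    (hx : x ∈ G.kempeChain c u) (hy : y ∈ G.kempeChain c u) (hxu : x ≠ u) (hyu : y ≠ u)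
    (hx' : ¬ G.HasColor c x 2 ∨ ¬ G.HasColor c x 3)
    (hy' : ¬ G.HasColor c y 2 ∨ ¬ G.HasColor c y 3) : x = y := by
  have key : ∀ {x y : α} {i j : ℕ}, x ≠ u → (¬ G.HasColor c x 2 ∨ ¬ G.HasColor c x 3) →
      Relation.ReflTransGen (G.KempeStep c) (u, 3) (x, i) →
      Relation.ReflTransGen (G.KempeStep c) (x, i) (y, j) → x = y := by
    intro x y i j hxu hx' h1 h2
    rcases Relation.ReflTransGen.cases_head h2 with h | ⟨⟨q, l⟩, ⟨hl, f, hf, hcf⟩, -⟩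
    · exact (Prod.mk.inj h).1
    rcases Relation.ReflTransGen.cases_tail h1 with h | ⟨⟨p, k⟩, -, hk, e, he, hce⟩
    · exact absurd (Prod.mk.inj h).1 hxu
    simp only at hl hf hcf hk he hce
    have hi : G.HasColor c x i := ⟨e, he.inc_right, hce⟩
    have hl' : G.HasColor c x l := ⟨f, hf.inc_left, hcf⟩
    rcases hl with ⟨rfl, rfl⟩ | ⟨rfl, rfl⟩ <;> tauto
  obtain ⟨i, hi⟩ := hx
  obtain ⟨j, hj⟩ := hy
  rcases Relation.ReflTransGen.total_of_right_unique (kempeStep_rightUnique hc) hi hj with h | h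
  · exact key hxu hx' hi h
  · exact (key hyu hy' hj h).symm

variable {K : Set α}

theorem kempeSwap_of_mem (he : G.Inc e x) (hx : x ∈ K) :
    G.kempeSwap c K e = Equiv.swap 2 3 (c e) := if_pos ⟨x, hx, he⟩

theorem IsKempeClosed.kempeSwap_of_notMem (hK : G.IsKempeClosed c K) (he : G.Inc e x)
    (hx : x ∉ K) : G.kempeSwap c K e = c e := by
  unfold kempeSwap
  split_ifs with h
  · obtain ⟨y, hy, hey⟩ := h
    obtain rfl | hxy := eq_or_ne x y
    · exact absurd hy hx
    have hl : G.IsLink e y x := by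
      obtain ⟨z, hz⟩ := hey
      rwa [he.eq_of_isLink_of_ne_left hz hxy]
    refine Equiv.swap_apply_of_ne_of_ne (fun h ↦ hx ?_) fun h ↦ hx ?_
    · exact hK hl (.inl h) hy
    · exact hK hl (.inr h) hy
  · rfl

theorem kempeSwap_eq_one_iff : G.kempeSwap c K e = 1 ↔ c e = 1 := by
  unfold kempeSwap
  split_ifs
  · rw [Equiv.swap_apply_def]
    grind
  · rfl

theorem IsKempeClosed.isProperEdgeColoring_kempeSwap (hK : G.IsKempeClosed c K)
    (hc : G.IsProperEdgeColoring 3 c) : G.IsProperEdgeColoring 3 (G.kempeSwap c K) := by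
  refine ⟨fun e he ↦ ?_, fun e f x hne he hf h ↦ ?_⟩
  · obtain ⟨x, y, hxy⟩ := G.exists_isLink_of_mem_edgeSet he
    have := hc.color_cases hxy.inc_left
    rw [kempeSwap, Set.mem_Icc, Equiv.swap_apply_def]
    split_ifs <;> omega
  · by_cases hx : x ∈ K
    · rw [kempeSwap_of_mem he hx, kempeSwap_of_mem hf hx] at h
      exact hc.2 e f x hne he hf (Equiv.injective _ h)
    · rw [hK.kempeSwap_of_notMem he hx, hK.kempeSwap_of_notMem hf hx] at h
      exact hc.2 e f x hne he hf h

theorem IsKempeClosed.isLightest_kempeSwap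
    (hK : G.IsKempeClosed c K) (hc : G.IsLightest E wt c) :
    G.IsLightest E wt (G.kempeSwap c K) := by
  refine ⟨hK.isProperEdgeColoring_kempeSwap hc.proper, fun d hd ↦ ?_⟩
  have : colorOneWeight E wt (G.kempeSwap c K) = colorOneWeight E wt c := by
    simp only [colorOneWeight, kempeSwap_eq_one_iff]
  exact this ▸ hc.le d hd

theorem hasColor_kempeSwap_of_mem (hx : x ∈ K) :
    G.HasColor (G.kempeSwap c K) x i ↔ G.HasColor c x (Equiv.swap 2 3 i) := by
  refine exists_congr fun e ↦ and_congr_right fun he ↦ ?_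
  rw [kempeSwap_of_mem he hx, Equiv.swap_apply_eq_iff]

theorem IsKempeClosed.hasColor_kempeSwap_of_notMem (hK : G.IsKempeClosed c K) (hx : x ∉ K) :
    G.HasColor (G.kempeSwap c K) x i ↔ G.HasColor c x i := by
  refine exists_congr fun e ↦ and_congr_right fun he ↦ ?_
  rw [hK.kempeSwap_of_notMem he hx]

end Kempe

/-! ### Tight edges in a lightest coloring -/

/-- One more than the least value of `D` at an end of `e`. -/
noncomputable def endWeight (G : Graph α β) (D : α → ℕ) (e : β) : ℕ :=
  1 + sInf (D '' {x | G.Inc e x})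

theorem endWeight_pos : 0 < G.endWeight D e := by
  unfold endWeight
  omega

theorem Inc.endWeight_le (h : G.Inc e x) : G.endWeight D e ≤ 1 + D x :=
  Nat.add_le_add_left (Nat.sInf_le (Set.mem_image_of_mem D h)) 1

theorem IsLink.le_endWeight (h : G.IsLink e u v) (hD : D v ≤ D u) : 1 + D v ≤ G.endWeight D e := by
  refine Nat.add_le_add_left ?_ 1
  obtain ⟨x, hx, hxe⟩ := Nat.sInf_mem (s := D '' {x | G.Inc e x}) ⟨_, u, h.inc_left, rfl⟩
  rw [← hxe]
  rcases Inc.eq_or_eq_of_isLink hx h with rfl | rfl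
  · exact hD
  · exact le_rfl

/-- An edge `e = uv` of color `1` such that color `3` is missing at `u` and color `2` at `v`. -/
structure IsTight (G : Graph α β) (c : β → ℕ) (e : β) (u v : α) : Prop where
  isLink : G.IsLink e u v
  color : c e = 1
  left : ¬ G.HasColor c u 3
  right : ¬ G.HasColor c v 2

/-- Otherwise recoloring `e` with `i` would save its weight, which is positive. -/
theorem IsLightest.hasColor_or (hc : G.IsLightest E (G.endWeight D) c) (hE : E(G) ⊆ E)
    (he : G.IsLink e u v) (h1 : c e = 1) (hi : i = 2 ∨ i = 3) :
    G.HasColor c u i ∨ G.HasColor c v i := by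
  classical
  by_contra! h
  have hp : G.IsProperEdgeColoring 3 (Function.update c e i) := by
    refine ⟨fun g hg ↦ ?_, fun g k x hne hg hk h' ↦ ?_⟩
    · have := hc.proper.1 g hg
      rw [Set.mem_Icc] at this ⊢
      rw [Function.update_apply]
      split_ifs <;> omega
    · have hg' := hg
      have hk' := hk
      have h0 := fun h ↦ hne (hc.proper.eq_of_inc hg hk h)
      have h3 : G.Inc g x → g = e → x = u ∨ x = v := fun h h' ↦ (h' ▸ h).eq_or_eq_of_isLink he
      have h4 : G.Inc k x → k = e → x = u ∨ x = v := fun h h' ↦ (h' ▸ h).eq_or_eq_of_isLink he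
      unfold HasColor at h
      simp only [Function.update_apply] at h'
      grind
  have h2 := colorOneWeight_update (c := c) (i := i) (wt := G.endWeight D) (hE he.edge_mem)
  have h3 := hc.le _ hp
  have h4 := endWeight_pos (G := G) (D := D) (e := e)
  rw [if_pos h1, if_neg (by omega)] at h2
  omega

namespace IsTight

variable (h : G.IsTight c e u v)

include h

theorem hasColor_left (hc : G.IsLightest E (G.endWeight D) c) (hE : E(G) ⊆ E) :
    G.HasColor c u 2 :=
  (hc.hasColor_or hE h.isLink h.color (.inl rfl)).resolve_right h.right

/-- Otherwise the swap along the chain leaves 2 missing at both ends of `e`, and `e` could take it.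
-/
theorem mem_kempeChain (hc : G.IsLightest E (G.endWeight D) c) (hE : E(G) ⊆ E) :
    v ∈ G.kempeChain c u := by
  by_contra hv
  have hK := isKempeClosed_kempeChain hc.proper h.left
  rcases (hK.isLightest_kempeSwap hc).hasColor_or hE h.isLink
    (kempeSwap_eq_one_iff.2 h.color) (.inl rfl) with h' | h'
  · rw [hasColor_kempeSwap_of_mem self_mem_kempeChain, Equiv.swap_apply_left] at h'
    exact h.left h'
  · rw [hK.hasColor_kempeSwap_of_notMem hv] at h'
    exact h.right h'

theorem ne (hc : G.IsLightest E (G.endWeight D) c) (hE : E(G) ⊆ E) : u ≠ v := by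
  rintro rfl
  exact h.right (h.hasColor_left hc hE)

theorem eq_or_eq_of_mem_kempeChain (hc : G.IsLightest E (G.endWeight D) c) (hE : E(G) ⊆ E)
    (hx : x ∈ G.kempeChain c u) (hx' : ¬ G.HasColor c x 2 ∨ ¬ G.HasColor c x 3) :
    x = u ∨ x = v := by
  by_contra! hne
  exact hne.2 (eq_of_mem_kempeChain hc.proper hx (h.mem_kempeChain hc hE) hne.1
    (h.ne hc hE).symm hx' (.inl h.right))

variable (hf : G.IsLink f v w) (hf3 : c f = 3)

include hf hf3

theorem mem_kempeChain_next (hc : G.IsLightest E (G.endWeight D) c) (hE : E(G) ⊆ E) :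
    w ∈ G.kempeChain c u :=
  isKempeClosed_kempeChain hc.proper h.left hf (.inr hf3) (h.mem_kempeChain hc hE)

theorem next_ne_left : w ≠ u := by
  rintro rfl
  exact h.left ⟨f, hf.inc_right, hf3⟩

theorem hasColor_two_next [G.Loopless] (hc : G.IsLightest E (G.endWeight D) c) (hE : E(G) ⊆ E) :
    G.HasColor c w 2 := by
  by_contra h2
  rcases h.eq_or_eq_of_mem_kempeChain hc hE (h.mem_kempeChain_next hf hf3 hc hE) (.inl h2)
    with h' | h'
  · exact h.next_ne_left hf hf3 h'
  · exact hf.ne h'.symm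

/-- As `v` misses 2, its only neighbors are `u` and `w`, and `u` is not closer. -/
theorem next_lt (hc : G.IsLightest E (G.endWeight D) c)
    (hD : D v ≤ D u) (hv : ∃ y, G.Adj v y ∧ D y < D v) : D w < D v := by
  obtain ⟨y, ⟨k, hk⟩, hy⟩ := hv
  rcases hc.proper.color_cases hk.inc_left with h' | h' | h'
  · obtain rfl := hc.proper.eq_of_inc hk.inc_left h.isLink.inc_right (h'.trans h.color.symm)
    obtain rfl := hk.right_unique h.isLink.symm
    omega
  · exact absurd ⟨k, hk.inc_left, h'⟩ h.right
  · obtain rfl := hc.proper.eq_of_inc hk.inc_left hf.inc_left (h'.trans hf3.symm)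
    rwa [← hk.right_unique hf]

theorem hasColor_one_next (hc : G.IsLightest E (G.endWeight D) c) (hE : E(G) ⊆ E)
    (hD : D v ≤ D u) (hv : ∃ y, G.Adj v y ∧ D y < D v) :
    G.HasColor c w 1 := by
  classical
  by_contra h1
  have hlt := h.next_lt hf hf3 hc hD hv
  have hef : e ≠ f := by
    rintro rfl
    have := h.color
    omega
  -- Color 1 moves from `e` to the lighter `f`, whose color 3 is then free at `v`.
  have hp : G.IsProperEdgeColoring 3 (Function.update (Function.update c e 3) f 1) := by
    refine ⟨fun g hg ↦ ?_, fun a b x hne ha hb h' ↦ ?_⟩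
    · have := hc.proper.1 g hg
      rw [Set.mem_Icc] at this ⊢
      simp only [Function.update_apply]
      split_ifs <;> omega
    · have h0 := fun h ↦ hne (hc.proper.eq_of_inc ha hb h)
      have k1 : ∀ a, G.Inc a x → a = e → x = u ∨ x = v :=
        fun a h1 h' ↦ (h' ▸ h1).eq_or_eq_of_isLink h.isLink
      have k2 : ∀ a, G.Inc a x → a = f → x = v ∨ x = w :=
        fun a h1 h' ↦ (h' ▸ h1).eq_or_eq_of_isLink hf
      have k3 : ∀ a, G.Inc a v → c a = 1 → a = e := fun a h1 h' ↦
        hc.proper.eq_of_inc h1 h.isLink.inc_right (h'.trans h.color.symm)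
      have k4 : ∀ a, G.Inc a v → c a = 3 → a = f := fun a h1 h' ↦
        hc.proper.eq_of_inc h1 hf.inc_left (h'.trans hf3.symm)
      have k5 := h.left
      unfold HasColor at h1 k5
      simp only [Function.update_apply] at h'
      grind
  have h2 := colorOneWeight_update (c := c) (i := 3) (wt := G.endWeight D)
    (hE h.isLink.edge_mem)
  have h3 := colorOneWeight_update (c := Function.update c e 3) (i := 1) (wt := G.endWeight D)
    (hE hf.edge_mem)
  have h4 := hc.le _ hp
  have h5 := h.isLink.le_endWeight hD
  have h6 := hf.inc_right.endWeight_le (D := D)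
  rw [if_pos h.color, if_neg (by omega)] at h2
  rw [if_pos rfl, Function.update_of_ne hef.symm, if_neg (by omega)] at h3
  omega

/-- If `z` misses 2, it lies off the chain, so the swap keeps this while `f` becomes 2 and `u` loses
2. Giving 2 to `e` and `g` and 1 to `f` then lowers the weight. -/
theorem hasColor_two_far [G.Loopless] (hc : G.IsLightest E (G.endWeight D) c) (hE : E(G) ⊆ E)
    (hD : D v ≤ D u) (hv : ∃ y, G.Adj v y ∧ D y < D v) (hg : G.IsLink g w z) (hg1 : c g = 1) :
    G.HasColor c z 2 := by
  classical
  by_contra hz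
  have hlt := h.next_lt hf hf3 hc hD hv
  have hwu := h.next_ne_left hf hf3
  have hge : g ≠ e := by
    rintro rfl
    rcases hg.inc_left.eq_or_eq_of_isLink h.isLink with h' | h'
    · exact hwu h'
    · exact hf.ne h'.symm
  have hef : e ≠ f := by
    rintro rfl
    have := h.color
    omega
  have hgf : g ≠ f := by
    rintro rfl
    omega
  have hzK : z ∉ G.kempeChain c u := by
    intro hzK
    rcases h.eq_or_eq_of_mem_kempeChain hc hE hzK (.inl hz) with rfl | rfl
    · exact hge (hc.proper.eq_of_inc hg.inc_right h.isLink.inc_left (hg1.trans h.color.symm))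
    · exact hge (hc.proper.eq_of_inc hg.inc_right h.isLink.inc_right (hg1.trans h.color.symm))
  have hK := isKempeClosed_kempeChain hc.proper h.left
  have hvK := h.mem_kempeChain hc hE
  have hu2 : ¬ G.HasColor (G.kempeSwap c (G.kempeChain c u)) u 2 := by
    rw [hasColor_kempeSwap_of_mem self_mem_kempeChain, Equiv.swap_apply_left]
    exact h.left
  have hv3 : ¬ G.HasColor (G.kempeSwap c (G.kempeChain c u)) v 3 := by
    rw [hasColor_kempeSwap_of_mem hvK, Equiv.swap_apply_right]
    exact h.right
  rw [← hK.hasColor_kempeSwap_of_notMem hzK] at hz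
  have he1 : G.kempeSwap c (G.kempeChain c u) e = 1 := kempeSwap_eq_one_iff.2 h.color
  rw [← kempeSwap_eq_one_iff (G := G) (K := G.kempeChain c u)] at hg1
  have hf2 : G.kempeSwap c (G.kempeChain c u) f = 2 := by
    rw [kempeSwap_of_mem hf.inc_left hvK, hf3, Equiv.swap_apply_right]
  replace hc := hK.isLightest_kempeSwap hc
  generalize G.kempeSwap c (G.kempeChain c u) = d at *
  have hp : G.IsProperEdgeColoring 3
      (Function.update (Function.update (Function.update d e 2) g 2) f 1) := by
    refine ⟨fun a ha ↦ ?_, fun a b x hne ha hb h' ↦ ?_⟩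
    · have := hc.proper.1 a ha
      rw [Set.mem_Icc] at this ⊢
      simp only [Function.update_apply]
      split_ifs <;> omega
    · have h0 := fun h ↦ hne (hc.proper.eq_of_inc ha hb h)
      have k1 : ∀ a, G.Inc a x → a = e → x = u ∨ x = v :=
        fun a h1 h' ↦ (h' ▸ h1).eq_or_eq_of_isLink h.isLink
      have k2 : ∀ a, G.Inc a x → a = f → x = v ∨ x = w :=
        fun a h1 h' ↦ (h' ▸ h1).eq_or_eq_of_isLink hf
      have k3 : ∀ a, G.Inc a x → a = g → x = w ∨ x = z :=
        fun a h1 h' ↦ (h' ▸ h1).eq_or_eq_of_isLink hg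
      have k4 : ∀ a, G.Inc a v → d a = 1 → a = e := fun a h1 h' ↦
        hc.proper.eq_of_inc h1 h.isLink.inc_right (h'.trans he1.symm)
      have k5 : ∀ a, G.Inc a v → d a = 2 → a = f := fun a h1 h' ↦
        hc.proper.eq_of_inc h1 hf.inc_left (h'.trans hf2.symm)
      have k6 : ∀ a, G.Inc a w → d a = 2 → a = f := fun a h1 h' ↦
        hc.proper.eq_of_inc h1 hf.inc_right (h'.trans hf2.symm)
      have k7 : ∀ a, G.Inc a w → d a = 1 → a = g := fun a h1 h' ↦
        hc.proper.eq_of_inc h1 hg.inc_left (h'.trans hg1.symm)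
      have k8 := h.isLink.ne
      have k9 := hf.ne
      have k10 := hg.ne
      have k11 : z ≠ u := by
        rintro rfl
        exact hge (hc.proper.eq_of_inc hg.inc_right h.isLink.inc_left (hg1.trans he1.symm))
      have k12 : z ≠ v := by
        rintro rfl
        exact hge (hc.proper.eq_of_inc hg.inc_right h.isLink.inc_right (hg1.trans he1.symm))
      unfold HasColor at hu2 hv3 hz
      simp only [Function.update_apply] at h'
      clear h hK hvK hzK hf3 hc hlt hv hD
      grind
  have h2 := colorOneWeight_update (c := d) (i := 2) (wt := G.endWeight D)
    (hE h.isLink.edge_mem)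
  have h3 := colorOneWeight_update (c := Function.update d e 2) (i := 2) (wt := G.endWeight D)
    (hE hg.edge_mem)
  have h4 := colorOneWeight_update (c := Function.update (Function.update d e 2) g 2) (i := 1)
    (wt := G.endWeight D) (hE hf.edge_mem)
  have h5 := hc.le _ hp
  have h6 := h.isLink.le_endWeight hD
  have h7 := hf.inc_right.endWeight_le (D := D)
  rw [if_pos he1, if_neg (by omega)] at h2
  rw [Function.update_of_ne hge, if_pos hg1, if_neg (by omega)] at h3
  rw [if_pos rfl, Function.update_of_ne hgf.symm, Function.update_of_ne hef.symm,
    if_neg (by omega)] at h4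
  omega

end IsTight

/-- Swapping along its chain, which contains both ends, reverses a tight edge and leaves color 1
alone. All wrongly oriented ones are reversed at once; no chain meets the end of another tight edge.
-/
theorem IsLightest.exists_forall_isTight_le (hc : G.IsLightest E (G.endWeight D) c)
    (hE : E(G) ⊆ E) : ∃ c', G.IsLightest E (G.endWeight D) c' ∧
      ∀ e u v, G.IsTight c' e u v → D v ≤ D u := by
  set K : Set α := {x | ∃ e u v, G.IsTight c e u v ∧ D u < D v ∧ x ∈ G.kempeChain c u} with hKdef
  have hK : G.IsKempeClosed c K := by
    rintro e x y he hce ⟨e', u, v, h, hlt, hx⟩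
    exact ⟨e', u, v, h, hlt, isKempeClosed_kempeChain hc.proper h.left he hce hx⟩
  have hc' := hK.isLightest_kempeSwap hc
  refine ⟨_, hc', fun e u v h ↦ ?_⟩
  have he : c e = 1 := kempeSwap_eq_one_iff.1 h.color
  have hl := h.left
  have hr := h.right
  -- an end of a tight edge in `K` is an end of a tight edge of `c` defining `K`
  have key : ∀ {x y}, x ∈ K → G.IsLink e x y → (¬ G.HasColor c x 2 ∨ ¬ G.HasColor c x 3) →
      (G.IsTight c e x y ∧ D x < D y) ∨ (G.IsTight c e y x ∧ D y < D x) := by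
    rintro x y ⟨e₁, u₁, v₁, h₁, hlt, hx⟩ hxy hx'
    rcases h₁.eq_or_eq_of_mem_kempeChain hc hE hx hx' with rfl | rfl
    · obtain rfl := hc.proper.eq_of_inc hxy.inc_left h₁.isLink.inc_left (he.trans h₁.color.symm)
      obtain rfl := hxy.right_unique h₁.isLink
      exact .inl ⟨h₁, hlt⟩
    · obtain rfl := hc.proper.eq_of_inc hxy.inc_left h₁.isLink.inc_right (he.trans h₁.color.symm)
      obtain rfl := hxy.right_unique h₁.isLink.symm
      exact .inr ⟨h₁, hlt⟩
  have aux : ∀ {x y}, G.IsTight c e x y → D x < D y → x ∈ K ∧ y ∈ K := fun h hlt ↦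
    ⟨⟨_, _, _, h, hlt, self_mem_kempeChain⟩, ⟨_, _, _, h, hlt, h.mem_kempeChain hc hE⟩⟩
  by_contra! hlt
  by_cases hu : u ∈ K
  · rw [hasColor_kempeSwap_of_mem hu, Equiv.swap_apply_right] at hl
    rcases key hu h.isLink (.inl hl) with ⟨h', -⟩ | ⟨-, h'⟩
    · exact hl (h'.hasColor_left hc hE)
    · omega
  · rw [hK.hasColor_kempeSwap_of_notMem hu] at hl
    by_cases hv : v ∈ K
    · rw [hasColor_kempeSwap_of_mem hv, Equiv.swap_apply_left] at hr
      rcases key hv h.isLink.symm (.inr hr) with ⟨h', h''⟩ | ⟨h', h''⟩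
      · exact hu (aux h' h'').2
      · exact hu (aux h' h'').1
    · rw [hK.hasColor_kempeSwap_of_notMem hv] at hr
      exact hu (aux ⟨h.isLink, he, hl, hr⟩ hlt).1

/-! ### Lifting a 3-coloring to an interval coloring -/

/-- The edge `f` leaves the end `v` of a tight edge `uv`. -/
def IsShifted (G : Graph α β) (c : β → ℕ) (f : β) : Prop :=
  ∃ e u v, G.IsTight c e u v ∧ G.Inc f v

open Classical in
/-- The interval coloring with colors `1, …, 5` obtained from a suitable proper `3`-edge coloring:
all colors agree modulo `3` with the original ones increased by `1`. -/
noncomputable def liftColoring (G : Graph α β) (c : β → ℕ) (e : β) : ℕ :=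
  if c e = 2 then 3
  else if c e = 3 then if G.IsShifted c e then 1 else 4
  else if (∃ x, G.Inc e x ∧ ¬ G.HasColor c x 2) ∧ ∀ x, G.Inc e x → G.HasColor c x 3 then 5 else 2

theorem liftColoring_of_two (h : c e = 2) : G.liftColoring c e = 3 := if_pos h

theorem liftColoring_of_three (h : c e = 3) :
    (G.IsShifted c e ∧ G.liftColoring c e = 1) ∨ (¬ G.IsShifted c e ∧ G.liftColoring c e = 4) := by
  rw [liftColoring, if_neg (by omega), if_pos h]
  by_cases hs : G.IsShifted c e
  · exact .inl ⟨hs, if_pos hs⟩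
  · exact .inr ⟨hs, if_neg hs⟩

theorem liftColoring_of_one (h : c e = 1) :
    (((∃ x, G.Inc e x ∧ ¬ G.HasColor c x 2) ∧ ∀ x, G.Inc e x → G.HasColor c x 3) ∧
      G.liftColoring c e = 5) ∨
    (((∃ x, G.Inc e x ∧ ¬ G.HasColor c x 2) → ∃ x, G.Inc e x ∧ ¬ G.HasColor c x 3) ∧
      G.liftColoring c e = 2) := by
  rw [liftColoring, if_neg (by omega), if_neg (by omega)]
  split_ifs with h'
  · exact .inl ⟨h', rfl⟩
  · refine .inr ⟨fun hx ↦ ?_, rfl⟩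
    by_contra! hy
    exact h' ⟨hx, hy⟩

theorem IsShifted.liftColoring_eq_two
    (h1 : ∀ e u v f w, G.IsTight c e u v → G.IsLink f v w → c f = 3 → G.HasColor c w 1)
    (h2 : ∀ e u v f w, G.IsTight c e u v → G.IsLink f v w → c f = 3 → G.HasColor c w 2)
    (h3 : ∀ e u v f w g z, G.IsTight c e u v → G.IsLink f v w → c f = 3 → G.IsLink g w z →
      c g = 1 → G.HasColor c z 2)
    (hf : G.IsShifted c f) (hf3 : c f = 3) (hx : G.Inc f x) :
    ∃ e, G.Inc e x ∧ c e = 1 ∧ G.liftColoring c e = 2 := by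
  obtain ⟨e, u, v, h, w, hw⟩ := hf
  rcases hx.eq_or_eq_of_isLink hw with rfl | rfl
  · refine ⟨e, h.isLink.inc_right, h.color, ?_⟩
    rcases liftColoring_of_one h.color with ⟨h', -⟩ | ⟨-, h'⟩
    · exact absurd (h'.2 u h.isLink.inc_left) h.left
    · exact h'
  · obtain ⟨g, ⟨z, hg⟩, hg1⟩ := h1 e u v f x h hw hf3
    refine ⟨g, hg.inc_left, hg1, ?_⟩
    rcases liftColoring_of_one hg1 with ⟨⟨⟨y, hy, hy2⟩, -⟩, -⟩ | ⟨-, h'⟩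
    · rcases hy.eq_or_eq_of_isLink hg with rfl | rfl
      · exact absurd (h2 e u v f y h hw hf3) hy2
      · exact absurd (h3 e u v f x g y h hw hf3 hg hg1) hy2
    · exact h'

theorem isIntervalColoring_liftColoring (hc : G.IsProperEdgeColoring 3 c)
    (h1 : ∀ e u v f w, G.IsTight c e u v → G.IsLink f v w → c f = 3 → G.HasColor c w 1)
    (h2 : ∀ e u v f w, G.IsTight c e u v → G.IsLink f v w → c f = 3 → G.HasColor c w 2)
    (h3 : ∀ e u v f w g z, G.IsTight c e u v → G.IsLink f v w → c f = 3 → G.IsLink g w z →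
      c g = 1 → G.HasColor c z 2) : G.IsIntervalColoring 5 (G.liftColoring c) := by
  have hcases : ∀ {e x}, G.Inc e x → c e = 2 ∧ G.liftColoring c e = 3 ∨
      c e = 3 ∧ (G.liftColoring c e = 1 ∨ G.liftColoring c e = 4) ∨
      c e = 1 ∧ (G.liftColoring c e = 2 ∨ G.liftColoring c e = 5) := by
    intro e x he
    rcases hc.color_cases he with h | h | h
    · have := liftColoring_of_one (G := G) h
      tauto
    · exact .inl ⟨h, liftColoring_of_two h⟩
    · have := liftColoring_of_three (G := G) h
      tauto
  refine ⟨⟨fun e he ↦ ?_, fun e f x hne he hf h ↦ ?_⟩, fun x _ ↦ ⟨?_⟩⟩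
  · obtain ⟨x, y, hxy⟩ := G.exists_isLink_of_mem_edgeSet he
    have := hcases hxy.inc_left
    rw [Set.mem_Icc]
    omega
  · have := hc.2 e f x hne he hf
    have := hcases he
    have := hcases hf
    omega
  · rintro _ ⟨e, he, rfl⟩ _ ⟨f, hf, rfl⟩ m ⟨hm1, hm2⟩
    rw [mem_incidenceSet] at he hf
    obtain rfl | hme := eq_or_ne m (G.liftColoring c e)
    · exact ⟨e, he, rfl⟩
    obtain rfl | hmf := eq_or_ne m (G.liftColoring c f)
    · exact ⟨f, hf, rfl⟩
    have hef : c e ≠ c f := fun h ↦ by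
      obtain rfl := hc.eq_of_inc he hf h
      omega
    have hlow : ∀ {f}, G.Inc f x → G.liftColoring c f = 1 →
        ∃ e, G.Inc e x ∧ c e = 1 ∧ G.liftColoring c e = 2 := by
      intro f hf hl
      have hf3 : c f = 3 := by
        have := hcases hf
        omega
      refine IsShifted.liftColoring_eq_two h1 h2 h3 ?_ hf3 hf
      rcases liftColoring_of_three hf3 (G := G) with h | h
      · exact h.1
      · omega
    have he' := hcases he
    have hf' := hcases hf
    -- The possible gaps: above 1, at 3 between 2 and 4, and at 4 below 5.
    have hsplit : (G.liftColoring c e = 1 ∧ c e = 3) ∨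
        (G.liftColoring c e = 2 ∧ c e = 1 ∧ G.liftColoring c f = 4 ∧ c f = 3 ∧ m = 3) ∨
        (G.liftColoring c f = 5 ∧ c f = 1 ∧ m = 4) := by omega
    rcases hsplit with ⟨h, -⟩ | ⟨he2, he1, hf4, hf3, rfl⟩ | ⟨hf5, hf1, rfl⟩
    · obtain ⟨g, hg, hg1, hg2⟩ := hlow he h
      have : c f = c g → f = g := hc.eq_of_inc hf hg
      obtain rfl | hfg := eq_or_ne f g
      · exact ⟨f, hf, by omega⟩
      · exact ⟨g, hg, by grind⟩
    · by_cases hx : G.HasColor c x 2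
      · obtain ⟨g, hg, hg2⟩ := hx
        exact ⟨g, hg, liftColoring_of_two hg2⟩
      · exfalso
        obtain ⟨u, hu, hu3⟩ : ∃ y, G.Inc e y ∧ ¬ G.HasColor c y 3 := by
          rcases liftColoring_of_one he1 (G := G) with h | h
          · omega
          · exact h.1 ⟨x, he, hx⟩
        have hux : G.IsLink e u x := by
          obtain ⟨y, hy⟩ := he
          rcases hu.eq_or_eq_of_isLink hy with rfl | rfl
          · exact absurd ⟨f, hf, hf3⟩ hu3
          · exact hy.symm
        rcases liftColoring_of_three hf3 (G := G) with h | h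
        · omega
        · exact h.1 ⟨e, u, x, ⟨hux, he1, hu3, hx⟩, hf⟩
    · have hx : G.HasColor c x 3 := by
        rcases liftColoring_of_one hf1 (G := G) with h | h
        · exact h.1.2 x hf
        · omega
      obtain ⟨g, hg, hg3⟩ := hx
      refine ⟨g, hg, ?_⟩
      have := hcases hg
      by_contra hne
      obtain ⟨k, hk, hk1, hk2⟩ := hlow hg (by omega)
      obtain rfl := hc.eq_of_inc hf hk (hf1.trans hk1.symm)
      omega

/-! ### Degrees, reduction modulo `Δ`, and the chromatic index -/

theorem degree_le_maxDegree (hV : V(G).Finite) (hv : v ∈ V(G)) : G.degree v ≤ G.maxDegree :=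
  le_csSup (hV.image _).bddAbove ⟨v, hv, rfl⟩

theorem exists_degree_eq_maxDegree (hV : V(G).Finite) (hne : V(G).Nonempty) :
    ∃ v ∈ V(G), G.degree v = G.maxDegree :=
  Nat.sSup_mem (hne.image _) (hV.image _).bddAbove

theorem IsProperEdgeColoring.injOn (hc : G.IsProperEdgeColoring t c) :
    Set.InjOn c (G.incidenceSet v) :=
  fun _ he _ hf h ↦ hc.eq_of_inc he hf h

theorem IsProperEdgeColoring.image_subset (hc : G.IsProperEdgeColoring t c) :
    c '' G.incidenceSet v ⊆ Set.Icc 1 t := by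
  rintro _ ⟨e, he, rfl⟩
  exact hc.1 e (Inc.edge_mem he)

theorem IsProperEdgeColoring.degree_le (hc : G.IsProperEdgeColoring t c) (v : α) :
    G.degree v ≤ t := by
  rw [degree, ← hc.injOn.ncard_image]
  exact (Set.ncard_le_ncard hc.image_subset (Set.finite_Icc 1 t)).trans_eq (by simp)

theorem IsProperEdgeColoring.hasColor_of_degree_eq (hc : G.IsProperEdgeColoring t c)
    (hv : G.degree v = t) (hi : i ∈ Set.Icc 1 t) : G.HasColor c v i := by
  have : c '' G.incidenceSet v = Set.Icc 1 t := by
    refine Set.eq_of_subset_of_ncard_le hc.image_subset ?_ (Set.finite_Icc 1 t)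
    rw [hc.injOn.ncard_image, ← degree, hv]
    simp
  exact this.symm.subset hi

/-- Reduction of an interval coloring modulo `Δ`. -/
theorem IsIntervalColoring.isProperEdgeColoring_mod (hV : V(G).Finite) (hE : E(G).Finite)
    (hc : G.IsIntervalColoring t c) :
    G.IsProperEdgeColoring G.maxDegree (fun e ↦ c e % G.maxDegree + 1) := by
  have hpos : ∀ {e v}, G.Inc e v → 0 < G.maxDegree := fun {e v} he ↦
    ((Set.ncard_pos (hE.subset (G.incidenceSet_subset_edgeSet v))).2 ⟨e, he⟩).trans_le
      (degree_le_maxDegree hV he.vertex_mem)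
  have key : ∀ {e f v}, G.Inc e v → G.Inc f v → c e < c f →
      c e % G.maxDegree ≠ c f % G.maxDegree := by
    intro e f v he hf hlt h
    have h1 : G.maxDegree ≤ c f - c e :=
      Nat.le_of_dvd (by omega) ((Nat.modEq_iff_dvd' hlt.le).1 h)
    have h2 : Set.Icc (c e) (c f) ⊆ c '' G.incidenceSet v :=
      (hc.2 v he.vertex_mem).out ⟨e, he, rfl⟩ ⟨f, hf, rfl⟩
    have h3 := Set.ncard_le_ncard h2 ((hE.subset (G.incidenceSet_subset_edgeSet v)).image c)
    rw [hc.1.injOn.ncard_image, ← degree] at h3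
    have h4 := degree_le_maxDegree hV he.vertex_mem
    simp only [Set.ncard_eq_toFinset_card', Set.toFinset_Icc, Nat.card_Icc] at h3
    omega
  refine ⟨fun e he ↦ ?_, fun e f v hne he hf h ↦ ?_⟩
  · obtain ⟨x, y, hxy⟩ := G.exists_isLink_of_mem_edgeSet he
    have := Nat.mod_lt (c e) (hpos hxy.inc_left)
    exact ⟨Nat.succ_pos _, this⟩
  · rcases lt_or_gt_of_ne (hc.1.2 e f v hne he hf) with hlt | hlt
    · exact key he hf hlt (by simpa using h)
    · exact key hf he hlt (by simpa using h.symm)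

theorem chromaticIndex_eq_maxDegree_iff (hV : V(G).Finite) (hE : E(G).Finite)
    (hne : V(G).Nonempty) :
    G.chromaticIndex = G.maxDegree ↔ ∃ c, G.IsProperEdgeColoring G.maxDegree c := by
  constructor
  · intro h
    -- Needed because `sInf ∅ = 0` would not give a coloring.
    have hns : {t | ∃ c, G.IsProperEdgeColoring t c}.Nonempty := by
      obtain ⟨c, hc⟩ := Set.countable_iff_exists_injOn.1 hE.countable
      obtain ⟨N, hN⟩ := (hE.image c).bddAbove
      refine ⟨N + 1, fun e ↦ c e + 1, fun e he ↦ ?_, fun e f v hne he hf h ↦ ?_⟩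
      · exact ⟨Nat.succ_pos _, Nat.succ_le_succ (hN ⟨e, he, rfl⟩)⟩
      · exact hne (hc he.edge_mem hf.edge_mem (by simpa using h))
    exact h ▸ Nat.sInf_mem hns
  · rintro ⟨c, hc⟩
    refine le_antisymm (Nat.sInf_le ⟨c, hc⟩) (le_csInf ⟨_, c, hc⟩ ?_)
    rintro t ⟨d, hd⟩
    obtain ⟨v, -, hv⟩ := exists_degree_eq_maxDegree hV hne
    exact hv ▸ hd.degree_le v

/-! ### Distance to the cubic vertices and conclusion -/

/-- The vertices within distance `n` of `S`. -/
def ballAround (G : Graph α β) (S : Set α) : ℕ → Set α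
  | 0 => S
  | n + 1 => {x | x ∈ ballAround G S n ∨ ∃ y ∈ ballAround G S n, G.Adj x y}

theorem IsConnected.exists_descending (hG : G.IsConnected) {S : Set α} (hS : ∃ s ∈ S, s ∈ V(G)) :
    ∃ D : α → ℕ, ∀ x ∈ V(G), x ∉ S → ∃ y, G.Adj x y ∧ D y < D x := by
  obtain ⟨s, hs, hsV⟩ := hS
  refine ⟨fun x ↦ sInf {n | x ∈ G.ballAround S n}, fun x hx hxS ↦ ?_⟩
  have hne : {n | x ∈ G.ballAround S n}.Nonempty := by
    have := hG.2 x hx s hsV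
    clear hxS hx
    induction this using Relation.ReflTransGen.head_induction_on with
    | refl => exact ⟨0, hs⟩
    | head h _ ih =>
      obtain ⟨n, hn⟩ := ih
      exact ⟨n + 1, .inr ⟨_, hn, h⟩⟩
  have hmem := Nat.sInf_mem hne
  match hn : sInf {n | x ∈ G.ballAround S n} with
  | 0 =>
    rw [hn] at hmem
    exact absurd hmem hxS
  | n + 1 =>
    rw [hn] at hmem
    rcases hmem with h | ⟨y, hy, hxy⟩
    · have := Nat.sInf_le (s := {n | x ∈ G.ballAround S n}) h
      omega
    · exact ⟨y, hxy, by simpa only [hn] using Nat.lt_succ_of_le (Nat.sInf_le hy)⟩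

theorem IsProperEdgeColoring.isIntervalColorable_of_le_two (hc : G.IsProperEdgeColoring t c)
    (ht : t ≤ 2) : G.IsIntervalColorable := by
  refine ⟨t, c, hc, fun v _ ↦ ⟨?_⟩⟩
  rintro _ ⟨e, he, rfl⟩ _ ⟨f, hf, rfl⟩ m ⟨hm1, hm2⟩
  have h1 := hc.1 e (Inc.edge_mem he)
  have h2 := hc.1 f (Inc.edge_mem hf)
  rw [Set.mem_Icc] at h1 h2
  obtain h | h : m = c e ∨ m = c f := by omega
  · exact ⟨e, he, h.symm⟩
  · exact ⟨f, hf, h.symm⟩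

theorem IsProperEdgeColoring.isIntervalColorable [G.Loopless] (hc : G.IsProperEdgeColoring 3 c)
    (hE : E(G).Finite) (hG : G.IsConnected) (hd : ∃ v ∈ V(G), G.degree v = 3) :
    G.IsIntervalColorable := by
  obtain ⟨v, hv, hv3⟩ := hd
  obtain ⟨D, hD⟩ := hG.exists_descending (S := {v | G.degree v = 3}) ⟨v, hv3, hv⟩
  obtain ⟨c₁, hc₁⟩ := hc.exists_isLightest hE.toFinset (G.endWeight D)
  have hE' : E(G) ⊆ hE.toFinset := by simp
  obtain ⟨d, hd, hle⟩ := hc₁.exists_forall_isTight_le hE'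
  -- Since `v` misses 2 it is not cubic, so its distance can be decreased.
  have hdesc : ∀ {e u v}, G.IsTight d e u v → ∃ y, G.Adj v y ∧ D y < D v := fun h ↦
    hD _ h.isLink.right_mem fun h' ↦
      h.right (hd.proper.hasColor_of_degree_eq h' (by simp))
  exact ⟨5, _, isIntervalColoring_liftColoring hd.proper
    (fun e u v f w h hf hf3 ↦ h.hasColor_one_next hf hf3 hd hE' (hle e u v h) (hdesc h))
    (fun e u v f w h hf hf3 ↦ h.hasColor_two_next hf hf3 hd hE')
    (fun e u v f w g z h hf hf3 hg hg1 ↦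
      h.hasColor_two_far hf hf3 hd hE' (hle e u v h) (hdesc h) hg hg1)⟩

end Graph

theorem mainTheorem3 {α β : Type*} (G : Graph α β) (hloop : G.Loopless)
    (hV : G.vertexSet.Finite) (hE : G.edgeSet.Finite)
    (hconn : G.IsConnected) (hcubic : G.maxDegree ≤ 3) :
    G.IsIntervalColorable ↔ G.chromaticIndex = G.maxDegree := by
  rw [Graph.chromaticIndex_eq_maxDegree_iff hV hE hconn.1]
  constructor
  · rintro ⟨t, c, hc⟩
    exact ⟨_, hc.isProperEdgeColoring_mod hV hE⟩
  · rintro ⟨c, hc⟩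
    rcases hcubic.lt_or_eq with h | h
    · exact hc.isIntervalColorable_of_le_two (by omega)
    · obtain ⟨v, hv, hv3⟩ := Graph.exists_degree_eq_maxDegree hV hconn.1
      rw [h] at hc hv3
      exact hc.isIntervalColorable hE hconn ⟨v, hv, hv3⟩
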